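/- Let $N\ge 0$, $w\ge 1$ and $0\le h\le N$ be integers. Let $\mathbf n\in\mathbb R^3$ be a unit vector and let $J_{\mathbf n}=\frac12\sum_{i=1}^N \mathbf n\cdot\boldsymbol\sigma^{(i)}$ be the collective spin operator of $N$ qubits, where $\boldsymbol\sigma^{(i)}$ is the vector of Pauli matrices acting on qubit $i$. For a density matrix $\rho=\sum_k\lambda_k|k\rangle\langle k|$ (spectral decomposition) and a Hermitian $H$, the quantum Fisher information is $$F_Q[\rho,H]=2\sum_{k,l:\ \lambda_k+\lambda_l>0}\frac{(\lambda_k-\lambda_l)^2}{\lambda_k+\lambda_l}\,|\langle k|H|l\rangle|^2 .$$ For a partition $\Lambda=\{A_1,\dots,A_m\}$ of the $N$ qubits into nonempty blocks, a state is $\Lambda$-separable if it is a finite convex combination of tensor products $\rho_{A_1}\otimes\cdots\otimes\rho_{A_m}$ of states of the blocks. Let $\mathcal L_{w,h}$ be the set of partitions all of whose blocks have at most $w$ elements and which have at least $h$ blocks. A state is $(w,h)$-separable if it has the form $\sum_{\Lambda\in\mathcal L_{w,h}}P_\Lambda\rho_\Lambda$ with a probability distribution $P$ on $\mathcal L_{w,h}$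 and $\Lambda$-separable states $\rho_\Lambda$. Put $$f_N(w,h)=\max_{\Lambda\in\mathcal L_{w,h}}\ \sum_{A\in\Lambda}|A|^2 .$$ Then the maximum defining $f_N(w,h)$ is taken over a nonempty set, and: 1. Every $(w,h)$-separable state $\rho$ satisfies $F_Q[\rho,J_{\mathbf n}]\le f_N(w,h)$ and $F_Q[\rho,J_{\mathbf n}]\le w(N-h)+N$; moreover $f_N(w,h)\le w(N-h)+N$. 2. The first bound is tight: $\max_{\rho}F_Q[\rho,J_{\mathbf n}]=f_N(w,h)$, the maximum being over all $(w,h)$-separable states $\rho$ and attained. 3. Let $\Lambda\in\mathcal L_{w,h}$ be any partition with $\sum_{A\in\Lambda}|A|^2=f_N(w,h)$. Then products of GHZ states over $\Lambda$ exist, and every such product, i.e. every pure state with vector $$\bigotimes_{A\in\Lambda}\frac{|{\downarrow}\rangle^{\otimes A}+e^{i\phi_A}|{\uparrow}\rangle^{\otimes A}}{\sqrt2},$$ where $|{\uparrow}\rangle,|{\downarrow}\rangle$ are unit eigenvectors of $\mathbf n\cdot\boldsymbol\sigma$ for the eigenvalues $+1,-1$ and $\phi_A\in\mathbb R$ are arbitrary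 phases, is $(w,h)$-separable and has $F_Q[\,\cdot\,,J_{\mathbf n}]=f_N(w,h)$. -/

import Mathlib

open scoped BigOperators Matrix ComplexOrder

noncomputable section

namespace WHSep

/-- A quantum state on a system whose computational basis is the finite type `ι`:
a positive semidefinite complex matrix of trace one. -/
structure DensityMatrix (ι : Type) [Fintype ι] where
  matrix : Matrix ι ι ℂ
  posSemidef : matrix.PosSemidef
  trace_eq_one : matrix.trace = 1

/-- Computational-basis labels of a register of qubits whose sites are indexed by `S`.
The label `0` is the eigenvalue `+1` of `σ_z`, the label `1` is the eigenvalue `-1`. -/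
abbrev Config (S : Type) : Type := S → Fin 2

/-! ### Quantum Fisher information -/

/-- The quantum Fisher information of the state `ρ` for the unitary family
`exp(-iθH) ρ exp(iθH)`: with a spectral decomposition `ρ = ∑ₖ λₖ |k⟩⟨k|`,
`F_Q[ρ,H] = 2 ∑_{k,l : λₖ+λₗ>0} (λₖ-λₗ)² / (λₖ+λₗ) |⟨k|H|l⟩|²`. -/
def qfi {ι : Type} [Fintype ι] [DecidableEq ι] (ρ : DensityMatrix ι) (H : Matrix ι ι ℂ) : ℝ :=
  let ev : ι → ℝ := ρ.posSemidef.isHermitian.eigenvalues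
  let ket : ι → ι → ℂ := fun k => (ρ.posSemidef.isHermitian.eigenvectorBasis k).ofLp
  2 * ∑ k, ∑ l, if 0 < ev k + ev l then
    (ev k - ev l) ^ 2 / (ev k + ev l) * ‖star (ket k) ⬝ᵥ (H *ᵥ ket l)‖ ^ 2 else 0

/-! ### Collective spin -/

/-- The vector `(σ_x, σ_y, σ_z)` of Pauli matrices. -/
def pauli : Fin 3 → Matrix (Fin 2) (Fin 2) ℂ :=
  ![!![0, 1; 1, 0], !![0, -Complex.I; Complex.I, 0], !![1, 0; 0, -1]]

/-- The single-qubit operator `n · σ`. -/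
def pauliDot (n : EuclideanSpace ℝ (Fin 3)) : Matrix (Fin 2) (Fin 2) ℂ :=
  ∑ a, (n a : ℂ) • pauli a

/-- The single-qubit operator `M` acting on the qubit `i` of a register of `N` qubits
(tensored with the identity on all other qubits). -/
def onSite {N : ℕ} (i : Fin N) (M : Matrix (Fin 2) (Fin 2) ℂ) :
    Matrix (Config (Fin N)) (Config (Fin N)) ℂ :=
  fun x y => if ∀ j, j ≠ i → x j = y j then M (x i) (y i) else 0

/-- The collective angular momentum operator `J_n = ∑ᵢ n · σ^{(i)} / 2`. -/
def collectiveSpin (N : ℕ) (n : EuclideanSpace ℝ (Fin 3)) :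
    Matrix (Config (Fin N)) (Config (Fin N)) ℂ :=
  (1 / 2 : ℂ) • ∑ i : Fin N, onSite i (pauliDot n)

/-! ### Partitions and separability -/

/-- Partitions of the set of `N` parties into nonempty disjoint blocks. -/
abbrev Partition (N : ℕ) : Type := Finpartition (Finset.univ : Finset (Fin N))

/-- The partitions whose largest block has at most `w` parties and which have at least
`h` blocks. -/
def classWH (N w h : ℕ) : Finset (Partition N) :=
  {Λ : Partition N | (∀ A ∈ Λ.parts, A.card ≤ w) ∧ h ≤ Λ.parts.card}

/-- The sum of the squared block sizes of a partition. -/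
def sumSq {N : ℕ} (Λ : Partition N) : ℕ := ∑ A ∈ Λ.parts, A.card ^ 2

/-- `f_N(w,h)`: the maximum of the sum of squared block sizes over `classWH N w h`. -/
def fMax (N w h : ℕ) : ℕ := (classWH N w h).sup sumSq

/-- The tensor product of local operators, one for each block of `Λ`. -/
def productMatrix {N : ℕ} (Λ : Partition N)
    (σ : ∀ A : Finset (Fin N), DensityMatrix (Config A)) :
    Matrix (Config (Fin N)) (Config (Fin N)) ℂ :=
  fun x y => ∏ A ∈ Λ.parts, (σ A).matrix (fun i => x i) (fun i => y i)

/-- `Λ`-separable states: convex mixtures of tensor products of states of the blocks of `Λ`. -/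
def IsSeparable {N : ℕ} (Λ : Partition N) (ρ : DensityMatrix (Config (Fin N))) : Prop :=
  ∃ (m : ℕ) (p : Fin m → ℝ) (σ : Fin m → ∀ A : Finset (Fin N), DensityMatrix (Config A)),
    (∀ γ, 0 ≤ p γ) ∧ ∑ γ, p γ = 1 ∧
      ρ.matrix = ∑ γ, (p γ : ℂ) • productMatrix Λ (σ γ)

/-- `(w,h)`-separable states: convex mixtures of `Λ`-separable states, where `Λ` ranges over
the partitions with all blocks of size at most `w` and with at least `h` blocks. -/
def IsWHSeparable {N : ℕ} (w h : ℕ) (ρ : DensityMatrix (Config (Fin N))) : Prop :=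
  ∃ (P : Partition N → ℝ) (R : Partition N → DensityMatrix (Config (Fin N))),
    (∀ Λ ∈ classWH N w h, 0 ≤ P Λ) ∧ ∑ Λ ∈ classWH N w h, P Λ = 1 ∧
      (∀ Λ ∈ classWH N w h, IsSeparable Λ (R Λ)) ∧
        ρ.matrix = ∑ Λ ∈ classWH N w h, (P Λ : ℂ) • (R Λ).matrix

/-! ### Products of GHZ states -/

/-- The GHZ vector `(|↓⟩^{⊗A} + e^{iφ} |↑⟩^{⊗A}) / √2` on the block `A`. -/
def ghz {N : ℕ} (down up : Fin 2 → ℂ) (φ : ℝ) (A : Finset (Fin N)) : Config A → ℂ :=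
  fun x => ((∏ i, down (x i)) + Complex.exp (Complex.I * φ) * (∏ i, up (x i))) / (√2 : ℝ)

/-- The product over the blocks `A` of `Λ` of the GHZ vectors with phases `φ A`. -/
def ghzProduct {N : ℕ} (down up : Fin 2 → ℂ) (φ : Finset (Fin N) → ℝ) (Λ : Partition N) :
    Config (Fin N) → ℂ :=
  fun x => ∏ A ∈ Λ.parts, ghz down up (φ A) A (fun i => x i)

/-- `ρ` is the pure state given by a product, over the blocks of `Λ`, of GHZ states in the
direction `n`: `|↑⟩` and `|↓⟩` are unit eigenvectors of `n · σ` with eigenvalues `+1`, `-1`. -/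
def IsGHZProduct {N : ℕ} (n : EuclideanSpace ℝ (Fin 3)) (Λ : Partition N)
    (ρ : DensityMatrix (Config (Fin N))) : Prop :=
  ∃ (down up : Fin 2 → ℂ) (φ : Finset (Fin N) → ℝ),
    star down ⬝ᵥ down = 1 ∧ star up ⬝ᵥ up = 1 ∧
      pauliDot n *ᵥ down = -down ∧ pauliDot n *ᵥ up = up ∧
        ρ.matrix = Matrix.vecMulVec (ghzProduct down up φ Λ) (star (ghzProduct down up φ Λ))

end WHSep

end

/-! Upper bound. `exists_qfi_functional` attaches to ρ a matrix `G`, built from the symmetric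
logarithmic derivative `L`, with `F_Q[ρ,H] = tr(ρG)` and `tr(τG) ≤ tr(τ(2H - c)²)` for every
positive semidefinite τ and real c. Since `G` depends only on ρ and `tr(·G)` is linear, it suffices
to bound `tr(τG)` for each product state τ in a decomposition of ρ; this replaces a separate proof
that the quantum Fisher information is convex. For τ a product over Λ, take `H = J_n` and c the mean
of `2J_n`. The right side is then a sum of covariances of single-site spins: those across blocks
vanish, and those within a block A add up to at most `|A|²`. This is `exists_secondMoment_le_sumSq`.

Attainment. For a pure state the quantum Fisher information is four times the variance
(`qfi_of_eq_vecMulVec`). In a product of GHZ states every single-site mean is 0, two spins in the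
same block have correlation 1, and spins in different blocks have correlation 0. So `4 Var(J_n)` is
exactly the sum of the squared block sizes (`IsGHZProduct.qfi_eq`).

The explicit bound on `f_N` is the blockwise inequality `a² ≤ w(a - 1) + a` for `1 ≤ a ≤ w`, summed
over at least h blocks. -/

namespace WHSep

open Matrix

/-! ### Quantum Fisher information: pure-state formula and variational bound -/

section QuantumFisherInformation

variable {ι : Type} [Fintype ι] [DecidableEq ι]

/-- The matrix of `H` in the eigenbasis of the state `ρ`. -/
noncomputable def inEigenbasis (ρ : DensityMatrix ι) (H : Matrix ι ι ℂ) : Matrix ι ι ℂ :=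
  (ρ.posSemidef.isHermitian.eigenvectorUnitary : Matrix ι ι ℂ)ᴴ * H *
    (ρ.posSemidef.isHermitian.eigenvectorUnitary : Matrix ι ι ℂ)

theorem inEigenbasis_apply (ρ : DensityMatrix ι) (H : Matrix ι ι ℂ) (k l : ι) :
    inEigenbasis ρ H k l =
      star (ρ.posSemidef.isHermitian.eigenvectorBasis k).ofLp ⬝ᵥ
        (H *ᵥ (ρ.posSemidef.isHermitian.eigenvectorBasis l).ofLp) := by
  rw [inEigenbasis, Matrix.mul_assoc, Matrix.mul_apply]
  simp only [dotProduct, Matrix.conjTranspose_apply, Matrix.mul_apply, mulVec, Pi.star_apply,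
    Matrix.IsHermitian.eigenvectorUnitary_apply]

theorem inEigenbasis_mul (ρ : DensityMatrix ι) (A B : Matrix ι ι ℂ) :
    inEigenbasis ρ (A * B) = inEigenbasis ρ A * inEigenbasis ρ B := by
  have hU := ρ.posSemidef.isHermitian.eigenvectorUnitary.2.2
  rw [star_eq_conjTranspose] at hU
  simp only [inEigenbasis, Matrix.mul_assoc]
  rw [← Matrix.mul_assoc _ (_ᴴ) (B * _), hU, Matrix.one_mul]

theorem inEigenbasis_self (ρ : DensityMatrix ι) :
    inEigenbasis ρ ρ.matrix =
      diagonal fun k => (ρ.posSemidef.isHermitian.eigenvalues k : ℂ) := by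
  have hU := ρ.posSemidef.isHermitian.eigenvectorUnitary.2.1
  rw [star_eq_conjTranspose] at hU
  have h := ρ.posSemidef.isHermitian.spectral_theorem
  rw [Unitary.conjStarAlgAut_apply, star_eq_conjTranspose] at h
  refine (congrArg (fun X => (ρ.posSemidef.isHermitian.eigenvectorUnitary : Matrix ι ι ℂ)ᴴ * X *
    (ρ.posSemidef.isHermitian.eigenvectorUnitary : Matrix ι ι ℂ)) h).trans ?_
  simp only [Matrix.mul_assoc]
  rw [hU, Matrix.mul_one, ← Matrix.mul_assoc, hU, Matrix.one_mul]
  rfl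

theorem trace_inEigenbasis (ρ : DensityMatrix ι) (A : Matrix ι ι ℂ) :
    (inEigenbasis ρ A).trace = A.trace := by
  have hU := ρ.posSemidef.isHermitian.eigenvectorUnitary.2.2
  rw [star_eq_conjTranspose] at hU
  rw [inEigenbasis, Matrix.trace_mul_comm, ← Matrix.mul_assoc, hU, Matrix.one_mul]

theorem inEigenbasis_isHermitian (ρ : DensityMatrix ι) {H : Matrix ι ι ℂ} (hH : H.IsHermitian) :
    (inEigenbasis ρ H).IsHermitian :=
  isHermitian_conjTranspose_mul_mul _ hH

theorem exists_inEigenbasis_eq (ρ : DensityMatrix ι) {L' : Matrix ι ι ℂ} (hL : L'.IsHermitian) :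
    ∃ L : Matrix ι ι ℂ, L.IsHermitian ∧ inEigenbasis ρ L = L' := by
  have hU := ρ.posSemidef.isHermitian.eigenvectorUnitary.2.1
  rw [star_eq_conjTranspose] at hU
  refine ⟨_, isHermitian_mul_mul_conjTranspose
    (ρ.posSemidef.isHermitian.eigenvectorUnitary : Matrix ι ι ℂ) hL, ?_⟩
  simp only [inEigenbasis, Matrix.mul_assoc]
  rw [hU, Matrix.mul_one, ← Matrix.mul_assoc, hU, Matrix.one_mul]

theorem trace_diagonal_mul_mul (d : ι → ℂ) (A B : Matrix ι ι ℂ) :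
    (diagonal d * (A * B)).trace = ∑ k, ∑ l, d k * (A k l * B l k) := by
  simp only [Matrix.trace, Matrix.diag, Matrix.diagonal_mul]
  simp only [Matrix.mul_apply, Finset.mul_sum]

theorem qfi_eq_sum (ρ : DensityMatrix ι) (H : Matrix ι ι ℂ) :
    qfi ρ H = 2 * ∑ k, ∑ l,
      if 0 < ρ.posSemidef.isHermitian.eigenvalues k + ρ.posSemidef.isHermitian.eigenvalues l then
        (ρ.posSemidef.isHermitian.eigenvalues k - ρ.posSemidef.isHermitian.eigenvalues l) ^ 2 /
          (ρ.posSemidef.isHermitian.eigenvalues k + ρ.posSemidef.isHermitian.eigenvalues l) *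
          ‖inEigenbasis ρ H k l‖ ^ 2 else 0 := by
  simp only [qfi, inEigenbasis_apply]

theorem IsHermitian.mul_apply_swap {κ : Type} {K : Matrix κ κ ℂ} (hK : K.IsHermitian) (k l : κ) :
    K k l * K l k = ((‖K k l‖ ^ 2 : ℝ) : ℂ) := by
  rw [← hK.apply l k, Complex.star_def, Complex.mul_conj, Complex.normSq_eq_norm_sq]

/-- The eigenvalues are 0 or 1, and for `a, b ∈ {0, 1}` the weight `(a - b)² / (a + b)`, read as 0
when `a = b = 0`, is the polynomial `a + b - 2ab`. The double sum therefore becomes a combination of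
traces. -/
theorem qfi_of_isIdempotentElem (ρ : DensityMatrix ι) (hρ : IsIdempotentElem ρ.matrix)
    {H : Matrix ι ι ℂ} (hH : H.IsHermitian) :
    (qfi ρ H : ℂ) =
      4 * ((ρ.matrix * (H * H)).trace - (ρ.matrix * (H * (ρ.matrix * H))).trace) := by
  have hK := inEigenbasis_isHermitian ρ hH
  rw [← trace_inEigenbasis ρ (ρ.matrix * (H * H)),
    ← trace_inEigenbasis ρ (ρ.matrix * (H * (ρ.matrix * H)))]
  simp only [inEigenbasis_mul, inEigenbasis_self, trace_diagonal_mul_mul, Matrix.diagonal_mul]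
  have hev : ∀ k, ρ.posSemidef.isHermitian.eigenvalues k = 0 ∨
      ρ.posSemidef.isHermitian.eigenvalues k = 1 := by
    intro k
    have h1 : inEigenbasis ρ (ρ.matrix * ρ.matrix) = inEigenbasis ρ ρ.matrix := by rw [hρ.eq]
    rw [inEigenbasis_mul, inEigenbasis_self, diagonal_mul_diagonal] at h1
    have h2 := congrFun (diagonal_injective h1) k
    have h3 : ρ.posSemidef.isHermitian.eigenvalues k * ρ.posSemidef.isHermitian.eigenvalues k
      = ρ.posSemidef.isHermitian.eigenvalues k := by exact_mod_cast h2
    exact (IsIdempotentElem.iff_eq_zero_or_one.mp h3)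
  rw [qfi_eq_sum]
  set ev := ρ.posSemidef.isHermitian.eigenvalues
  set K := inEigenbasis ρ H
  have hsym : ∑ k, ∑ l, (ev k : ℂ) * (K k l * K l k) =
      ∑ k, ∑ l, (ev l : ℂ) * (K k l * K l k) := by
    rw [Finset.sum_comm]
    refine Finset.sum_congr rfl fun k _ => Finset.sum_congr rfl fun l _ => by ring
  have key : ∀ k l, (((if 0 < ev k + ev l then
        (ev k - ev l) ^ 2 / (ev k + ev l) * ‖K k l‖ ^ 2 else 0 : ℝ)) : ℂ) =
      (ev k : ℂ) * (K k l * K l k) + (ev l : ℂ) * (K k l * K l k)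
        - 2 * ((ev k : ℂ) * (K k l * ((ev l : ℂ) * K l k))) := by
    intro k l
    have h : (ev k : ℂ) * (K k l * K l k) + (ev l : ℂ) * (K k l * K l k)
        - 2 * ((ev k : ℂ) * (K k l * ((ev l : ℂ) * K l k))) =
        (ev k + ev l - 2 * ev k * ev l) * (K k l * K l k) := by ring
    rw [h, IsHermitian.mul_apply_swap hK]
    rcases hev k with h1 | h1 <;> rcases hev l with h2 | h2 <;> simp [h1, h2]
    norm_num
  have hsum : ((∑ k, ∑ l, if 0 < ev k + ev l then
        (ev k - ev l) ^ 2 / (ev k + ev l) * ‖K k l‖ ^ 2 else 0 : ℝ) : ℂ) =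
      ∑ k, ∑ l, (ev k : ℂ) * (K k l * K l k) + ∑ k, ∑ l, (ev l : ℂ) * (K k l * K l k)
        - 2 * ∑ k, ∑ l, ((ev k : ℂ) * (K k l * ((ev l : ℂ) * K l k))) := by
    simp only [Complex.ofReal_sum, key, Finset.sum_add_distrib, Finset.sum_sub_distrib,
      Finset.mul_sum]
  rw [Complex.ofReal_mul, hsum, ← hsym, Complex.ofReal_ofNat]
  ring

/-- The symmetric logarithmic derivative turns the quantum Fisher information into the value of a
linear functional that is bounded by four times the variance on every state. -/
theorem exists_qfi_functional (ρ : DensityMatrix ι) {H : Matrix ι ι ℂ} (hH : H.IsHermitian) :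
    ∃ G : Matrix ι ι ℂ, qfi ρ H = (ρ.matrix * G).trace.re ∧
      ∀ τ : Matrix ι ι ℂ, τ.PosSemidef → ∀ c : ℝ,
        (τ * G).trace.re ≤
          (τ * (((2 : ℂ) • H - (c : ℂ) • 1) * ((2 : ℂ) • H - (c : ℂ) • 1))).trace.re := by
  have hK := inEigenbasis_isHermitian ρ hH
  have hnn : ∀ k, 0 ≤ ρ.posSemidef.isHermitian.eigenvalues k := ρ.posSemidef.eigenvalues_nonneg
  have hq := qfi_eq_sum ρ H
  have hs := inEigenbasis_self ρ
  set ev := ρ.posSemidef.isHermitian.eigenvalues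
  set K := inEigenbasis ρ H with hKdef
  -- Division by zero gives `c k l = 0` when both eigenvalues vanish, which agrees with the terms
  -- left out of the definition of `qfi`.
  let c : ι → ι → ℝ := fun k l => (ev k - ev l) / (ev k + ev l)
  have hc : ∀ k l, c l k = - c k l := fun k l => by
    simp only [c]; rw [← neg_div, neg_sub, add_comm]
  let L' : Matrix ι ι ℂ := fun k l => 2 * Complex.I * (c k l : ℂ) * K k l
  have hL' : L'.IsHermitian := by
    ext k l
    have h2 : star (c l k : ℂ) = -(c k l : ℂ) := by
      rw [Complex.star_def, Complex.conj_ofReal, hc k l, Complex.ofReal_neg]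
    change star (2 * Complex.I * (c l k : ℂ) * K l k) = 2 * Complex.I * (c k l : ℂ) * K k l
    rw [star_mul', star_mul', hK.apply k l, h2]
    simp
  obtain ⟨L, hL, hLL⟩ := exists_inEigenbasis_eq ρ hL'
  -- The trace of ρ against the commutator term is twice the quantum Fisher information, and
  -- `tr(ρL²)` equals it once, so the difference is the required value.
  refine ⟨(2 * Complex.I) • (H * L - L * H) - L * L, ?_, ?_⟩
  · have hsum : ∀ k l, (if 0 < ev k + ev l then
        (ev k - ev l) ^ 2 / (ev k + ev l) * ‖K k l‖ ^ 2 else 0) =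
          (ev k - ev l) * c k l * ‖K k l‖ ^ 2 := by
      intro k l
      split_ifs with h
      · simp only [c]; ring
      · have : ev k + ev l = 0 := le_antisymm (not_lt.mp h) (add_nonneg (hnn k) (hnn l))
        simp [c, this]
    have hcc : ∀ k l, (ev k + ev l) * (c k l * c k l) = (ev k - ev l) * c k l := by
      intro k l
      rcases (add_nonneg (hnn k) (hnn l)).eq_or_lt with h | h
      · simp [c, ← h]
      · simp only [c]; field_simp
    simp only [hsum] at hq
    have h1 : (ρ.matrix * (H * L)).trace =
        ((∑ k, ∑ l, ev k * (2 * c k l * ‖K k l‖ ^ 2) : ℝ) : ℂ) * -Complex.I := by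
      rw [← trace_inEigenbasis ρ]
      simp only [inEigenbasis_mul, hs, hLL, trace_diagonal_mul_mul]
      push_cast
      rw [Finset.sum_mul]
      refine Finset.sum_congr rfl fun k _ => ?_
      rw [Finset.sum_mul]
      refine Finset.sum_congr rfl fun l _ => ?_
      have := IsHermitian.mul_apply_swap hK k l
      push_cast at this
      rw [← this]
      simp only [L', hc k l, ← hKdef]
      push_cast
      ring
    have h2 : (ρ.matrix * (L * H)).trace =
        ((∑ k, ∑ l, ev k * (2 * c k l * ‖K k l‖ ^ 2) : ℝ) : ℂ) * Complex.I := by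
      rw [← trace_inEigenbasis ρ]
      simp only [inEigenbasis_mul, hs, hLL, trace_diagonal_mul_mul]
      push_cast
      rw [Finset.sum_mul]
      refine Finset.sum_congr rfl fun k _ => ?_
      rw [Finset.sum_mul]
      refine Finset.sum_congr rfl fun l _ => ?_
      have := IsHermitian.mul_apply_swap hK k l
      push_cast at this
      rw [← this]
      simp only [L', ← hKdef]
      ring
    have h3 : (ρ.matrix * (L * L)).trace =
        ((∑ k, ∑ l, ev k * (4 * (c k l * c k l) * ‖K k l‖ ^ 2) : ℝ) : ℂ) := by
      rw [← trace_inEigenbasis ρ]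
      simp only [inEigenbasis_mul, hs, hLL, trace_diagonal_mul_mul]
      push_cast
      refine Finset.sum_congr rfl fun k _ => ?_
      refine Finset.sum_congr rfl fun l _ => ?_
      have := IsHermitian.mul_apply_swap hK k l
      push_cast at this
      rw [← this]
      simp only [L', hc k l]
      push_cast
      linear_combination (-4 * (ev k : ℂ) * c k l * c k l * K k l * K l k) * Complex.I_sq
    have hns : ∀ k l, ‖K l k‖ = ‖K k l‖ := fun k l => by rw [← hK.apply k l, norm_star]
    -- Averaging with the swap of k and l: `c` is antisymmetric and `‖K k l‖` symmetric, so the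
    -- weight `ev k` becomes half of `ev k - ev l`. In `s2` the factor `c²` is symmetric, which
    -- gives half of `ev k + ev l` and lets `hcc` apply.
    have s1 : ∑ k, ∑ l, ev k * (2 * c k l * ‖K k l‖ ^ 2) =
        ∑ k, ∑ l, (ev k - ev l) * c k l * ‖K k l‖ ^ 2 := by
      have : ∑ k, ∑ l, ev k * (2 * c k l * ‖K k l‖ ^ 2) =
          ∑ k, ∑ l, -(ev l * (2 * c k l * ‖K k l‖ ^ 2)) := by
        rw [Finset.sum_comm]
        refine Finset.sum_congr rfl fun k _ => Finset.sum_congr rfl fun l _ => ?_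
        rw [hc k l, hns k l]; ring
      have h' : ∑ k, ∑ l, (ev k - ev l) * c k l * ‖K k l‖ ^ 2 =
          (1 / 2) * (∑ k, ∑ l, ev k * (2 * c k l * ‖K k l‖ ^ 2) +
            ∑ k, ∑ l, -(ev l * (2 * c k l * ‖K k l‖ ^ 2))) := by
        simp only [← Finset.sum_add_distrib, Finset.mul_sum]
        refine Finset.sum_congr rfl fun k _ => Finset.sum_congr rfl fun l _ => ?_
        ring
      linarith
    have s2 : ∑ k, ∑ l, ev k * (4 * (c k l * c k l) * ‖K k l‖ ^ 2) =
        2 * ∑ k, ∑ l, (ev k - ev l) * c k l * ‖K k l‖ ^ 2 := by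
      have : ∑ k, ∑ l, ev k * (4 * (c k l * c k l) * ‖K k l‖ ^ 2) =
          ∑ k, ∑ l, ev l * (4 * (c k l * c k l) * ‖K k l‖ ^ 2) := by
        rw [Finset.sum_comm]
        refine Finset.sum_congr rfl fun k _ => Finset.sum_congr rfl fun l _ => ?_
        rw [hc k l, hns k l]; ring
      have h' : ∑ k, ∑ l, (ev k - ev l) * c k l * ‖K k l‖ ^ 2 =
          (1 / 4) * (∑ k, ∑ l, ev k * (4 * (c k l * c k l) * ‖K k l‖ ^ 2) +
            ∑ k, ∑ l, ev l * (4 * (c k l * c k l) * ‖K k l‖ ^ 2)) := by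
        simp only [← Finset.sum_add_distrib, Finset.mul_sum]
        refine Finset.sum_congr rfl fun k _ => Finset.sum_congr rfl fun l _ => ?_
        rw [← hcc k l]
        ring
      linarith
    have : (ρ.matrix * ((2 * Complex.I) • (H * L - L * H) - L * L)).trace =
        ((2 * ∑ k, ∑ l, (ev k - ev l) * c k l * ‖K k l‖ ^ 2 : ℝ) : ℂ) := by
      rw [Matrix.mul_sub, Matrix.mul_smul, Matrix.mul_sub, trace_sub, trace_smul, trace_sub,
        h1, h2, h3, s1, s2, smul_eq_mul]
      push_cast
      linear_combination (-4 * ∑ k, ∑ l, ((ev k : ℂ) - ev l) * c k l * ‖K k l‖ ^ 2) * Complex.I_sq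
    rw [this, Complex.ofReal_re, hq]
  · intro τ hτ a
    set M := (2 : ℂ) • H - (a : ℂ) • (1 : Matrix ι ι ℂ) with hM
    have hMh : M.IsHermitian := by
      rw [hM, Matrix.IsHermitian, conjTranspose_sub, conjTranspose_smul, conjTranspose_smul,
        hH.eq, conjTranspose_one]
      simp
    -- The scalar shift commutes with `L`, so `G` is unaffected by the choice of centre `a`.
    have hML : (2 : ℂ) • (H * L - L * H) = M * L - L * M := by
      rw [hM]
      simp [Matrix.sub_mul, Matrix.mul_sub, smul_sub]
    have hpos : 0 ≤ (τ * ((L + Complex.I • M)ᴴ * (L + Complex.I • M))).trace := by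
      rw [← Matrix.mul_assoc, Matrix.trace_mul_comm, ← Matrix.mul_assoc]
      exact (hτ.mul_mul_conjTranspose_same _).trace_nonneg
    -- Completing the square: `M² - G` is a positive operator.
    have hexp : (L + Complex.I • M)ᴴ * (L + Complex.I • M) =
        M * M - ((2 * Complex.I) • (H * L - L * H) - L * L) := by
      rw [mul_comm (2 : ℂ), mul_smul, hML, conjTranspose_add, conjTranspose_smul, hL.eq, hMh.eq]
      simp only [Matrix.add_mul, Matrix.mul_add, Matrix.smul_mul, Matrix.mul_smul, smul_sub, smul_add]
      have hI : Complex.I • Complex.I • (M * M) = -(M * M) := by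
        rw [smul_smul, Complex.I_mul_I, neg_smul, one_smul]
      simp only [hI, Complex.star_def, Complex.conj_I, neg_smul, smul_neg]
      abel
    rw [hexp, Matrix.mul_sub, trace_sub] at hpos
    have := (Complex.le_def.mp hpos).1
    simp only [Complex.zero_re, Complex.sub_re] at this
    linarith

end QuantumFisherInformation

/-! ### Tensor products of single-qubit operators -/

section Tensor

variable {S : Type} [Fintype S] [DecidableEq S]

/-- The tensor product of single-qubit operators. -/
def tensorOp : (S → Matrix (Fin 2) (Fin 2) ℂ) →* Matrix (Config S) (Config S) ℂ where
  toFun M := Matrix.of fun x y => ∏ i, M i (x i) (y i)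
  map_one' := by
    ext x y
    simp only [Pi.one_apply, Matrix.one_apply, Matrix.of_apply]
    split_ifs with h
    · simp [h]
    · obtain ⟨i, hi⟩ := Function.ne_iff.mp h
      exact Finset.prod_eq_zero (Finset.mem_univ i) (if_neg hi)
  map_mul' M M' := by
    ext x y
    simp only [Matrix.of_apply, Pi.mul_apply, Matrix.mul_apply, Finset.prod_univ_sum, Fintype.piFinset_univ,
      Finset.prod_mul_distrib]

theorem tensorOp_apply (M : S → Matrix (Fin 2) (Fin 2) ℂ) (x y : Config S) :
    tensorOp M x y = ∏ i, M i (x i) (y i) := rfl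

theorem tensorOp_isHermitian {M : S → Matrix (Fin 2) (Fin 2) ℂ} (hM : ∀ i, (M i).IsHermitian) :
    (tensorOp M).IsHermitian := by
  ext x y
  rw [conjTranspose_apply, tensorOp_apply, tensorOp_apply, star_prod]
  exact Finset.prod_congr rfl fun i _ => (hM i).apply _ _

/-- The product vector with the single-qubit factor `v` on every site. -/
def productVec (v : Fin 2 → ℂ) : Config S → ℂ := fun x => ∏ i, v (x i)

theorem tensorOp_mulVec_productVec (M : S → Matrix (Fin 2) (Fin 2) ℂ) (u v : Fin 2 → ℂ) :
    star (productVec u) ⬝ᵥ (tensorOp M *ᵥ productVec v) =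
      ∏ i, star u ⬝ᵥ (M i *ᵥ v) := by
  simp only [dotProduct, mulVec, Finset.prod_univ_sum, Fintype.piFinset_univ,
    productVec, Pi.star_apply, tensorOp_apply, star_prod, Finset.prod_mul_distrib]

end Tensor

theorem onSite_eq_tensorOp {N : ℕ} (i : Fin N) (M : Matrix (Fin 2) (Fin 2) ℂ) :
    onSite i M = tensorOp (Pi.mulSingle i M) := by
  ext x y
  rw [tensorOp_apply, onSite]
  split_ifs with h
  · rw [Finset.prod_eq_single i]
    · simp
    · intro j _ hj
      rw [Pi.mulSingle_eq_of_ne hj, h j hj, Matrix.one_apply_eq]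
    · simp
  · push Not at h
    obtain ⟨j, hj, hxy⟩ := h
    refine (Finset.prod_eq_zero (Finset.mem_univ j) ?_).symm
    rw [Pi.mulSingle_eq_of_ne hj, Matrix.one_apply_ne hxy]

/-! ### Product states over a partition: factorisation, trace, positivity -/

section Blocks

variable {N : ℕ} (Λ : Partition N)

theorem prod_parts_prod {R : Type*} [CommMonoid R] (f : Fin N → R) :
    ∏ A ∈ Λ.parts, ∏ i : A, f i = ∏ i, f i := by
  conv_rhs => rw [← Λ.biUnion_parts, Finset.prod_biUnion Λ.supIndep.pairwiseDisjoint]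
  refine Finset.prod_congr rfl fun A _ => ?_
  exact Finset.prod_coe_sort A f

theorem sum_parts_sum {R : Type*} [AddCommMonoid R] (f : Fin N → R) :
    ∑ A ∈ Λ.parts, ∑ i ∈ A, f i = ∑ i, f i := by
  conv_rhs => rw [← Λ.biUnion_parts, Finset.sum_biUnion Λ.supIndep.pairwiseDisjoint]
  rfl

/-- A configuration of the register is a family of configurations of the blocks. -/
noncomputable def configEquiv : Config (Fin N) ≃ ∀ A : Λ.parts, Config A.1 :=
  (((Equiv.subtypeUnivEquiv fun i => Finset.mem_univ i).symm.trans
    Λ.equivSigmaParts).arrowCongr (Equiv.refl (Fin 2))).trans (Equiv.piCurry fun _ _ => Fin 2)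

theorem configEquiv_apply (x : Config (Fin N)) (A : Λ.parts) :
    configEquiv Λ x A = fun i : A.1 => x i := rfl

/-- A sum over configurations of a product over blocks factorises. -/
theorem sum_prod_parts (f : ∀ A : Finset (Fin N), Config A → ℂ) :
    ∑ x : Config (Fin N), ∏ A ∈ Λ.parts, f A (fun i => x i) =
      ∏ A ∈ Λ.parts, ∑ z : Config A, f A z := by
  rw [← Finset.prod_coe_sort Λ.parts fun A => ∑ z : Config A, f A z, Finset.prod_univ_sum,
    Fintype.piFinset_univ, ← (configEquiv Λ).sum_comp]
  refine Finset.sum_congr rfl fun x _ => ?_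
  simp only [configEquiv_apply]
  exact (Finset.prod_coe_sort Λ.parts fun A => f A fun i => x i).symm

theorem sum_sum_prod_parts (f : ∀ A : Finset (Fin N), Config A → Config A → ℂ) :
    ∑ x : Config (Fin N), ∑ y : Config (Fin N),
        ∏ A ∈ Λ.parts, f A (fun i => x i) (fun i => y i) =
      ∏ A ∈ Λ.parts, ∑ z : Config A, ∑ z' : Config A, f A z z' := by
  rw [← sum_prod_parts]
  refine Finset.sum_congr rfl fun x _ => ?_
  rw [sum_prod_parts Λ fun A z => f A (fun i => x i) z]

theorem trace_productMatrix_mul_tensorOp (σ : ∀ A : Finset (Fin N), DensityMatrix (Config A))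
    (M : Fin N → Matrix (Fin 2) (Fin 2) ℂ) :
    (productMatrix Λ σ * tensorOp M).trace =
      ∏ A ∈ Λ.parts, ((σ A).matrix * tensorOp fun i : A => M i).trace := by
  simp only [Matrix.trace, Matrix.diag, Matrix.mul_apply, productMatrix, tensorOp_apply]
  rw [← sum_sum_prod_parts Λ fun A x y => (σ A).matrix x y * ∏ i : A, M i (y i) (x i)]
  simp only [Finset.prod_mul_distrib, prod_parts_prod Λ fun i => M i _ _]

theorem trace_productMatrix (σ : ∀ A : Finset (Fin N), DensityMatrix (Config A)) :
    (productMatrix Λ σ).trace = 1 := by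
  have h := trace_productMatrix_mul_tensorOp Λ σ 1
  rw [map_one, Matrix.mul_one] at h
  rw [h]
  refine Finset.prod_eq_one fun A _ => ?_
  have : (tensorOp fun i : A => (1 : Fin N → Matrix (Fin 2) (Fin 2) ℂ) i) = 1 := map_one tensorOp
  rw [this, Matrix.mul_one, (σ A).trace_eq_one]

-- Write each factor as `Bᴴ * B`; the blockwise product `C` of the `B`s then satisfies `Cᴴ * C =
-- productMatrix Λ σ`.
open scoped MatrixOrder Matrix.Norms.L2Operator in
theorem productMatrix_posSemidef (σ : ∀ A : Finset (Fin N), DensityMatrix (Config A)) :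
    (productMatrix Λ σ).PosSemidef := by
  have h : ∀ A : Finset (Fin N), ∃ B : Matrix (Config A) (Config A) ℂ, (σ A).matrix = Bᴴ * B := fun A =>
    CStarAlgebra.nonneg_iff_eq_star_mul_self.mp (σ A).posSemidef.nonneg
  choose B hB using h
  let C : Matrix (Config (Fin N)) (Config (Fin N)) ℂ :=
    fun x y => ∏ A ∈ Λ.parts, B A (fun i => x i) (fun i => y i)
  have : productMatrix Λ σ = Cᴴ * C := by
    ext x y
    simp only [productMatrix, hB, Matrix.mul_apply, conjTranspose_apply]
    rw [← sum_prod_parts Λ fun A z => star (B A z fun i => x i) * B A z fun i => y i]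
    simp only [Finset.prod_mul_distrib]
    refine Finset.sum_congr rfl fun z _ => ?_
    rw [← star_prod]
  rw [this]
  exact posSemidef_conjTranspose_mul_self _

/-- Expectation values in a product state factorise over operators with disjoint block
supports. -/
theorem trace_productMatrix_mul_mulSingle_mul (σ : ∀ A : Finset (Fin N), DensityMatrix (Config A))
    (M : Matrix (Fin 2) (Fin 2) ℂ) {A B : Finset (Fin N)} (hA : A ∈ Λ.parts) (hB : B ∈ Λ.parts)
    (hAB : A ≠ B) {i j : Fin N} (hi : i ∈ A) (hj : j ∈ B) :
    (productMatrix Λ σ * (onSite i M * onSite j M)).trace =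
      (productMatrix Λ σ * onSite i M).trace * (productMatrix Λ σ * onSite j M).trace := by
  simp only [onSite_eq_tensorOp, ← map_mul]
  simp only [trace_productMatrix_mul_tensorOp, ← Finset.prod_mul_distrib]
  have hone : ∀ {C : Finset (Fin N)} {k : Fin N}, k ∉ C → ∀ a : C,
      (Pi.mulSingle k M : Fin N → Matrix (Fin 2) (Fin 2) ℂ) a = 1 := fun hk a => by
    rw [Pi.mulSingle_eq_of_ne]
    exact fun h => hk (h ▸ a.2)
  have htr : ∀ C : Finset (Fin N), ((σ C).matrix * tensorOp fun _ : C => (1 : Matrix (Fin 2) (Fin 2) ℂ)).trace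
      = 1 := fun C => by
    have : (tensorOp fun _ : C => (1 : Matrix (Fin 2) (Fin 2) ℂ)) = 1 := map_one tensorOp
    rw [this, Matrix.mul_one, (σ C).trace_eq_one]
  -- No block contains both sites, so in each block at least one of the two operators is the
  -- identity, with expectation 1.
  refine Finset.prod_congr rfl fun C hC => ?_
  by_cases hCi : i ∈ C
  · have : j ∉ C := fun hj' => hAB
      ((Λ.eq_of_mem_parts hC hA hCi hi).symm.trans (Λ.eq_of_mem_parts hC hB hj' hj))
    simp only [Pi.mul_apply, hone this, mul_one, htr]
  · simp only [Pi.mul_apply, hone hCi, one_mul, htr]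

end Blocks

/-! ### Spin operators -/

section Pauli

theorem pauliDot_eq (n : EuclideanSpace ℝ (Fin 3)) :
    pauliDot n = !![(n 2 : ℂ), n 0 - n 1 * Complex.I; n 0 + n 1 * Complex.I, -n 2] := by
  ext i j
  fin_cases i <;> fin_cases j <;>
    simp [pauliDot, pauli, Fin.sum_univ_three, Matrix.add_apply, sub_eq_add_neg]

theorem pauliDot_isHermitian (n : EuclideanSpace ℝ (Fin 3)) : (pauliDot n).IsHermitian := by
  rw [pauliDot_eq]
  ext i j
  fin_cases i <;> fin_cases j <;> simp [sub_eq_add_neg]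

theorem trace_pauliDot (n : EuclideanSpace ℝ (Fin 3)) : (pauliDot n).trace = 0 := by
  rw [pauliDot_eq]
  simp [Matrix.trace_fin_two]

theorem pauliDot_mul_self {n : EuclideanSpace ℝ (Fin 3)} (hn : ‖n‖ = 1) :
    pauliDot n * pauliDot n = 1 := by
  have h : (n 0) ^ 2 + (n 1) ^ 2 + (n 2) ^ 2 = 1 := by
    have := EuclideanSpace.norm_sq_eq n
    rw [hn, Fin.sum_univ_three] at this
    simpa using this.symm
  have hc : (n 0 : ℂ) ^ 2 + (n 1 : ℂ) ^ 2 + (n 2 : ℂ) ^ 2 = 1 := by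
    simpa using congrArg Complex.ofReal h
  rw [pauliDot_eq]
  ext i j
  fin_cases i <;> fin_cases j <;> simp [Matrix.mul_apply, Fin.sum_univ_two]
  · linear_combination hc - (n 1 : ℂ) ^ 2 * Complex.I_sq
  · ring
  · ring
  · linear_combination hc - (n 1 : ℂ) ^ 2 * Complex.I_sq

theorem onSite_isHermitian {N : ℕ} (i : Fin N) {M : Matrix (Fin 2) (Fin 2) ℂ}
    (hM : M.IsHermitian) : (onSite i M).IsHermitian := by
  rw [onSite_eq_tensorOp]
  refine tensorOp_isHermitian fun j => ?_
  rcases eq_or_ne j i with rfl | h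
  · simpa using hM
  · rw [Pi.mulSingle_eq_of_ne h]
    exact isHermitian_one

theorem onSite_mul_self {N : ℕ} (i : Fin N) {M : Matrix (Fin 2) (Fin 2) ℂ} (hM : M * M = 1) :
    onSite i M * onSite i M = 1 := by
  rw [onSite_eq_tensorOp, ← map_mul, ← Pi.mulSingle_mul, hM, Pi.mulSingle_one, map_one]

theorem collectiveSpin_isHermitian (N : ℕ) (n : EuclideanSpace ℝ (Fin 3)) :
    (collectiveSpin N n).IsHermitian := by
  rw [collectiveSpin, Matrix.IsHermitian, conjTranspose_smul, conjTranspose_sum]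
  simp only [(onSite_isHermitian _ (pauliDot_isHermitian n)).eq]
  simp

theorem two_smul_collectiveSpin (N : ℕ) (n : EuclideanSpace ℝ (Fin 3)) :
    (2 : ℂ) • collectiveSpin N n = ∑ i : Fin N, onSite i (pauliDot n) := by
  rw [collectiveSpin, smul_smul]
  norm_num

end Pauli

/-! ### The upper bound on separable states -/

section Bounds

variable {ι : Type} [Fintype ι] [DecidableEq ι]

theorem ofReal_re_trace_mul {κ : Type} [Fintype κ] {A B : Matrix κ κ ℂ} (hA : A.IsHermitian) (hB : B.IsHermitian) :
    (((A * B).trace.re : ℝ) : ℂ) = (A * B).trace := by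
  refine Complex.conj_eq_iff_re.mp ?_
  rw [← Complex.star_def, ← trace_conjTranspose, conjTranspose_mul, hA.eq, hB.eq,
    Matrix.trace_mul_comm]

/-- Expand `0 ≤ tr(τ(A - B)²) = 2 - 2 Re tr(τAB)`. -/
theorem re_trace_mul_mul_le_one {τ A B : Matrix ι ι ℂ} (hτ : τ.PosSemidef) (h1 : τ.trace = 1)
    (hA : A.IsHermitian) (hB : B.IsHermitian) (hA1 : A * A = 1) (hB1 : B * B = 1) :
    (τ * (A * B)).trace.re ≤ 1 := by
  have hpos : 0 ≤ (τ * ((A - B)ᴴ * (A - B))).trace := by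
    rw [← Matrix.mul_assoc, Matrix.trace_mul_comm, ← Matrix.mul_assoc]
    exact (hτ.mul_mul_conjTranspose_same _).trace_nonneg
  have hsw : (τ * (B * A)).trace = star (τ * (A * B)).trace := by
    rw [← trace_conjTranspose, conjTranspose_mul, conjTranspose_mul, hA.eq, hB.eq,
      hτ.isHermitian.eq, Matrix.trace_mul_comm]
  rw [conjTranspose_sub, hA.eq, hB.eq, Matrix.sub_mul, Matrix.mul_sub B, Matrix.mul_sub A, hA1, hB1,
    Matrix.mul_sub, Matrix.mul_sub, Matrix.mul_sub, Matrix.mul_one, trace_sub, trace_sub,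
    trace_sub, h1, hsw] at hpos
  have := (Complex.le_def.mp hpos).1
  simp only [Complex.zero_re, Complex.sub_re, Complex.one_re, Complex.star_def,
    Complex.conj_re] at this
  linarith

variable {N : ℕ}

/-- In a product state over `Λ`, the second moment of `2 J` around its mean is at most the sum of
the squared block sizes. -/
theorem exists_secondMoment_le_sumSq (Λ : Partition N)
    (σ : ∀ A : Finset (Fin N), DensityMatrix (Config A))
    {n : EuclideanSpace ℝ (Fin 3)} (hn : ‖n‖ = 1) :
    ∃ c : ℝ, (productMatrix Λ σ * (((2 : ℂ) • collectiveSpin N n - (c : ℂ) • 1) *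
      ((2 : ℂ) • collectiveSpin N n - (c : ℂ) • 1))).trace.re ≤ sumSq Λ := by
  set τ := productMatrix Λ σ with hτdef
  have hτ : τ.PosSemidef := productMatrix_posSemidef Λ σ
  have hτ1 : τ.trace = 1 := trace_productMatrix Λ σ
  set S : Fin N → Matrix (Config (Fin N)) (Config (Fin N)) ℂ := fun i => onSite i (pauliDot n)
  have hS : ∀ i, (S i).IsHermitian := fun i => onSite_isHermitian i (pauliDot_isHermitian n)
  have hS1 : ∀ i, S i * S i = 1 := fun i => onSite_mul_self i (pauliDot_mul_self hn)
  set s : Fin N → ℝ := fun i => (τ * S i).trace.re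
  have hs : ∀ i, (τ * S i).trace = (s i : ℂ) := fun i =>
    (ofReal_re_trace_mul hτ.isHermitian (hS i)).symm
  set T : Fin N → Fin N → ℝ := fun i j => (τ * (S i * S j)).trace.re
  -- Centring at the mean of `2J` turns the second moment into the sum of the covariances `T i j - s
  -- i * s j`.
  refine ⟨∑ i, s i, ?_⟩
  have hsum : (2 : ℂ) • collectiveSpin N n - ((∑ i, s i : ℝ) : ℂ) •
      (1 : Matrix (Config (Fin N)) (Config (Fin N)) ℂ) = ∑ i, (S i - (s i : ℂ) • 1) := by
    rw [two_smul_collectiveSpin, Finset.sum_sub_distrib, ← Finset.sum_smul, Complex.ofReal_sum]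
  have hterm : ∀ i j, (τ * ((S i - (s i : ℂ) • 1) * (S j - (s j : ℂ) • 1))).trace.re =
      T i j - s i * s j := by
    intro i j
    have : (τ * ((S i - (s i : ℂ) • 1) * (S j - (s j : ℂ) • 1))).trace =
        (τ * (S i * S j)).trace - (s i * s j : ℝ) := by
      simp only [Matrix.sub_mul, Matrix.mul_sub, Matrix.smul_mul, Matrix.mul_smul, Matrix.one_mul,
        Matrix.mul_one, trace_sub, trace_smul, hs, hτ1, smul_eq_mul]
      push_cast
      ring
    rw [this, Complex.sub_re, Complex.ofReal_re]
  rw [hsum, Finset.sum_mul_sum, Matrix.mul_sum, trace_sum, Complex.re_sum]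
  simp only [Matrix.mul_sum, trace_sum, Complex.re_sum, hterm]
  have hzero : ∀ A ∈ Λ.parts, ∀ i ∈ A, ∀ B ∈ Λ.parts, B ≠ A → ∀ j ∈ B,
      T i j - s i * s j = 0 := by
    intro A hA i hi B hB hBA j hj
    have h := trace_productMatrix_mul_mulSingle_mul Λ σ (pauliDot n) hA hB hBA.symm hi hj
    change (τ * (S i * S j)).trace = (τ * S i).trace * (τ * S j).trace at h
    rw [hs, hs, ← Complex.ofReal_mul] at h
    simp only [T, h, Complex.ofReal_re, sub_self]
  rw [← sum_parts_sum Λ, sumSq, Nat.cast_sum]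
  refine Finset.sum_le_sum fun A hA => ?_
  have hblock : ∀ i ∈ A, ∑ j, (T i j - s i * s j) = ∑ j ∈ A, (T i j - s i * s j) := by
    intro i hi
    rw [← sum_parts_sum Λ]
    refine Finset.sum_eq_single_of_mem A hA fun B hB hBA => ?_
    exact Finset.sum_eq_zero fun j hj => hzero A hA i hi B hB hBA j hj
  rw [Finset.sum_congr rfl hblock]
  simp only [Finset.sum_sub_distrib]
  rw [← Finset.sum_mul_sum]
  have hT : ∑ i ∈ A, ∑ j ∈ A, T i j ≤ ∑ i ∈ A, ∑ j ∈ A, (1 : ℝ) :=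
    Finset.sum_le_sum fun i _ => Finset.sum_le_sum fun j _ =>
      re_trace_mul_mul_le_one hτ hτ1 (hS i) (hS j) (hS1 i) (hS1 j)
  have hcard : ∑ i ∈ A, ∑ j ∈ A, (1 : ℝ) = ((A.card ^ 2 : ℕ) : ℝ) := by
    simp [sq]
  -- Within a block the products of means add up to a perfect square, which is dropped.
  nlinarith [mul_self_nonneg (∑ i ∈ A, s i)]

theorem re_trace_sum_smul_mul_le {κ : Type} [Fintype κ] {ν : Type*} (s : Finset ν) (p : ν → ℝ)
    (τ : ν → Matrix κ κ ℂ) (G : Matrix κ κ ℂ) (b : ℝ) (hp : ∀ k ∈ s, 0 ≤ p k)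
    (hp1 : ∑ k ∈ s, p k = 1) (hb : ∀ k ∈ s, (τ k * G).trace.re ≤ b) :
    ((∑ k ∈ s, (p k : ℂ) • τ k) * G).trace.re ≤ b := by
  rw [Finset.sum_mul, trace_sum, Complex.re_sum]
  calc ∑ k ∈ s, ((p k : ℂ) • τ k * G).trace.re ≤ ∑ k ∈ s, p k * b := by
        refine Finset.sum_le_sum fun k hk => ?_
        rw [Matrix.smul_mul, trace_smul, smul_eq_mul, Complex.re_ofReal_mul]
        exact mul_le_mul_of_nonneg_left (hb k hk) (hp k hk)
    _ = b := by rw [← Finset.sum_mul, hp1, one_mul]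

/-- Linearity of `tr(·G)` removes both layers of mixing, over partitions and over product states.
The centre `c` may differ from one product state to another because the bound on `G` holds for all
centres. -/
theorem qfi_le_fMax {w h : ℕ} {n : EuclideanSpace ℝ (Fin 3)} (hn : ‖n‖ = 1)
    {ρ : DensityMatrix (Config (Fin N))} (hρ : IsWHSeparable w h ρ) :
    qfi ρ (collectiveSpin N n) ≤ fMax N w h := by
  obtain ⟨G, hG, hle⟩ := exists_qfi_functional ρ (collectiveSpin_isHermitian N n)
  obtain ⟨P, R, hP, hP1, hR, hρR⟩ := hρ
  rw [hG, hρR]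
  refine re_trace_sum_smul_mul_le _ P _ G _ hP hP1 fun Λ hΛ => ?_
  obtain ⟨m, p, σ, hp, hp1, hRΛ⟩ := hR Λ hΛ
  rw [hRΛ]
  refine re_trace_sum_smul_mul_le _ p _ G _ (fun k _ => hp k) hp1 fun k _ => ?_
  obtain ⟨c, hc⟩ := exists_secondMoment_le_sumSq Λ (σ k) hn
  refine ((hle _ (productMatrix_posSemidef Λ (σ k)) c).trans hc).trans ?_
  exact_mod_cast Finset.le_sup (f := sumSq) hΛ

end Bounds

/-! ### Sums of squared block sizes -/

section Combinatorics

variable {N : ℕ}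

theorem sumSq_le {w h : ℕ} {Λ : Partition N} (hΛ : Λ ∈ classWH N w h) :
    (sumSq Λ : ℝ) ≤ (w : ℝ) * ((N : ℝ) - h) + N := by
  obtain ⟨hw, hh⟩ := (Finset.mem_filter.mp hΛ).2
  have hcard : ∑ A ∈ Λ.parts, (A.card : ℝ) = N := by
    have := Λ.sum_card_parts
    rw [Finset.card_univ, Fintype.card_fin] at this
    exact_mod_cast this
  have hle : (sumSq Λ : ℝ) ≤ ∑ A ∈ Λ.parts, ((w : ℝ) * ((A.card : ℝ) - 1) + A.card) := by
    rw [sumSq, Nat.cast_sum]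
    refine Finset.sum_le_sum fun A hA => ?_
    have h1 : (1 : ℝ) ≤ A.card := by exact_mod_cast (Λ.nonempty_of_mem_parts hA).card_pos
    have h2 : (A.card : ℝ) ≤ w := by exact_mod_cast hw A hA
    push_cast
    nlinarith
  refine hle.trans ?_
  rw [Finset.sum_add_distrib, ← Finset.mul_sum, Finset.sum_sub_distrib, hcard]
  simp only [Finset.sum_const, nsmul_eq_mul, mul_one]
  have : (h : ℝ) ≤ Λ.parts.card := by exact_mod_cast hh
  gcongr

/-- The partition into singletons makes the class nonempty, so the `sup` in `fMax` is an attained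
maximum and not the default value 0. -/
theorem bot_mem_classWH {w h : ℕ} (hw : 1 ≤ w) (hh : h ≤ N) :
    (⊥ : Partition N) ∈ classWH N w h := by
  refine Finset.mem_filter.mpr ⟨Finset.mem_univ _, fun A hA => ?_, ?_⟩
  · obtain ⟨i, _, rfl⟩ := (Finpartition.mem_bot_iff).mp hA
    simpa using hw
  · rwa [Finpartition.card_bot, Finset.card_univ, Fintype.card_fin]

theorem exists_sumSq_eq_fMax {w h : ℕ} (hw : 1 ≤ w) (hh : h ≤ N) :
    ∃ Λ ∈ classWH N w h, sumSq Λ = fMax N w h := by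
  obtain ⟨Λ, hΛ, heq⟩ := Finset.exists_mem_eq_sup _ ⟨_, bot_mem_classWH hw hh⟩ (sumSq (N := N))
  exact ⟨Λ, hΛ, heq.symm⟩

end Combinatorics

/-! ### Quantum Fisher information of pure states -/

section PureStates

variable {ι : Type} [Fintype ι] [DecidableEq ι]

theorem trace_vecMulVec_mul {κ : Type} [Fintype κ] (ψ : κ → ℂ) (X : Matrix κ κ ℂ) :
    (vecMulVec ψ (star ψ) * X).trace = star ψ ⬝ᵥ (X *ᵥ ψ) := by
  rw [Matrix.trace_mul_comm, Matrix.mul_vecMulVec, trace_vecMulVec, dotProduct_comm]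

theorem qfi_of_eq_vecMulVec {ρ : DensityMatrix ι} {ψ : ι → ℂ}
    (hρ : ρ.matrix = vecMulVec ψ (star ψ)) {H : Matrix ι ι ℂ} (hH : H.IsHermitian) :
    (qfi ρ H : ℂ) = 4 * ((ρ.matrix * (H * H)).trace - (ρ.matrix * H).trace ^ 2) := by
  have h1 : star ψ ⬝ᵥ ψ = 1 := by
    rw [dotProduct_comm, ← trace_vecMulVec, ← hρ, ρ.trace_eq_one]
  have hid : IsIdempotentElem ρ.matrix := by
    rw [IsIdempotentElem, hρ, Matrix.vecMulVec_mul_vecMulVec, h1, one_smul]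
  have h2 : (ρ.matrix * (H * (ρ.matrix * H))).trace = (ρ.matrix * H).trace ^ 2 := by
    rw [hρ, trace_vecMulVec_mul, trace_vecMulVec_mul, Matrix.vecMulVec_mul, Matrix.mul_vecMulVec,
      Matrix.vecMulVec_mulVec, ← Matrix.dotProduct_mulVec]
    simp [sq]
  rw [qfi_of_isIdempotentElem ρ hid hH, h2]

end PureStates

/-! ### Eigenvectors of a spin component -/

section Eigenvectors

/-- As `M² = 1`, the range of `1 + M` consists of vectors fixed by `M`; it is nonzero because `1 +
M` has trace 2. -/
theorem exists_unit_eigenvector {M : Matrix (Fin 2) (Fin 2) ℂ} (hM : M * M = 1)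
    (ht : M.trace = 0) : ∃ v : Fin 2 → ℂ, star v ⬝ᵥ v = 1 ∧ M *ᵥ v = v := by
  have hne : (1 + M) ≠ 0 := fun h => by
    have := congrArg Matrix.trace h
    simp [ht] at this
  obtain ⟨w, hw⟩ : ∃ w, (1 + M) *ᵥ w ≠ 0 := by
    by_contra! h
    exact hne (Matrix.ext_of_mulVec_single fun i => by rw [h, Matrix.zero_mulVec])
  set u := (1 + M) *ᵥ w
  have hu : M *ᵥ u = u := by
    simp only [u, Matrix.mulVec_mulVec, Matrix.mul_add, hM, Matrix.mul_one, add_comm]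
  have hpos : 0 < star u ⬝ᵥ u := dotProduct_star_self_pos_iff.mpr hw
  obtain ⟨r, hr, hru⟩ : ∃ r : ℝ, 0 < r ∧ star u ⬝ᵥ u = r := by
    have h := Complex.lt_def.mp hpos
    exact ⟨_, h.1, Complex.ext rfl h.2.symm⟩
  refine ⟨((√r)⁻¹ : ℂ) • u, ?_, ?_⟩
  · have hs : ((√r : ℝ) : ℂ) ^ 2 = r := by exact_mod_cast Real.sq_sqrt hr.le
    have hs0 : ((√r : ℝ) : ℂ) ≠ 0 := by exact_mod_cast (Real.sqrt_pos.mpr hr).ne'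
    rw [star_smul, smul_dotProduct, dotProduct_smul, hru, smul_eq_mul, smul_eq_mul, ← hs,
      star_inv₀, Complex.star_def, Complex.conj_ofReal]
    field_simp
  · rw [Matrix.mulVec_smul, hu]

theorem star_dotProduct_eq_zero_of_eigen {M : Matrix (Fin 2) (Fin 2) ℂ} (hM : M.IsHermitian)
    {u v : Fin 2 → ℂ} (hu : M *ᵥ u = -u) (hv : M *ᵥ v = v) : star u ⬝ᵥ v = 0 := by
  have h : star (M *ᵥ u) ⬝ᵥ v = star u ⬝ᵥ (M *ᵥ v) := by
    rw [star_mulVec, hM.eq, Matrix.dotProduct_mulVec]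
  rw [hu, hv, star_neg, neg_dotProduct] at h
  exact self_eq_neg.mp h.symm

theorem exists_eigenvectors_pauliDot {n : EuclideanSpace ℝ (Fin 3)} (hn : ‖n‖ = 1) :
    ∃ down up : Fin 2 → ℂ, star down ⬝ᵥ down = 1 ∧ star up ⬝ᵥ up = 1 ∧
      pauliDot n *ᵥ down = -down ∧ pauliDot n *ᵥ up = up := by
  obtain ⟨u, hu1, hu⟩ := exists_unit_eigenvector (pauliDot_mul_self hn) (trace_pauliDot n)
  obtain ⟨d, hd1, hd⟩ := exists_unit_eigenvector (M := -pauliDot n)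
    (by rw [neg_mul_neg, pauliDot_mul_self hn]) (by rw [trace_neg, trace_pauliDot, neg_zero])
  refine ⟨d, u, hd1, hu1, ?_, hu⟩
  rw [← neg_eq_iff_eq_neg, ← Matrix.neg_mulVec, hd]

end Eigenvectors

/-! ### Products of GHZ states attain the bound -/

section GHZ

variable {N : ℕ}

theorem ghz_eq (d u : Fin 2 → ℂ) (φ : ℝ) (A : Finset (Fin N)) :
    ghz d u φ A = (((√2 : ℝ) : ℂ)⁻¹) •
      (productVec d + Complex.exp (Complex.I * φ) • productVec u) := by
  ext x
  simp only [ghz, Pi.smul_apply, Pi.add_apply, productVec, smul_eq_mul, div_eq_inv_mul]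

theorem star_exp_I_mul_self (φ : ℝ) :
    star (Complex.exp (Complex.I * φ)) * Complex.exp (Complex.I * φ) = 1 := by
  rw [Complex.star_def, ← Complex.exp_conj, ← Complex.exp_add]
  simp

/-- Expectation value in a GHZ state of a tensor product of operators that have `u` and `d` as
eigenvectors, with eigenvalues `1` and `α`. -/
theorem ghz_dotProduct_tensorOp {d u : Fin 2 → ℂ} (hd : star d ⬝ᵥ d = 1) (hu : star u ⬝ᵥ u = 1)
    (hdu : star d ⬝ᵥ u = 0) (φ : ℝ) {A : Finset (Fin N)} (hA : A.Nonempty)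
    {M : A → Matrix (Fin 2) (Fin 2) ℂ} {α : A → ℂ} (hMd : ∀ a, M a *ᵥ d = α a • d)
    (hMu : ∀ a, M a *ᵥ u = u) :
    star (ghz d u φ A) ⬝ᵥ (tensorOp M *ᵥ ghz d u φ A) = (∏ a, α a + 1) / 2 := by
  have hud : star u ⬝ᵥ d = 0 := by
    rw [star_dotProduct, hdu, star_zero]
  have hne : Nonempty A := hA.to_subtype
  have h2 : (((√2 : ℝ) : ℂ)⁻¹) * ((√2 : ℝ) : ℂ)⁻¹ = 1 / 2 := by
    rw [← mul_inv, ← Complex.ofReal_mul, Real.mul_self_sqrt zero_le_two]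
    norm_num
  have hs2 : star (((√2 : ℝ) : ℂ)⁻¹) = ((√2 : ℝ) : ℂ)⁻¹ := by
    rw [star_inv₀, Complex.star_def, Complex.conj_ofReal]
  -- The cross terms between `d` and `u` are products of zeros over the sites of `A`; they vanish
  -- only because `A` is nonempty.
  have h0 : ∏ _a : A, (0 : ℂ) = 0 := by
    rw [Finset.prod_const, Finset.card_univ, zero_pow Fintype.card_ne_zero]
  have he := star_exp_I_mul_self φ
  rw [ghz_eq]
  set e := Complex.exp (Complex.I * φ)
  simp only [star_smul, star_add, Matrix.mulVec_smul, Matrix.mulVec_add, smul_dotProduct,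
    dotProduct_smul, add_dotProduct, dotProduct_add, tensorOp_mulVec_productVec, hMd, hMu, hd, hu,
    hdu, hud, smul_eq_mul, hs2, mul_zero, mul_one, h0, Finset.prod_const_one, zero_add, add_zero]
  linear_combination (∏ a, α a + 1) * h2 + (((√2 : ℝ) : ℂ)⁻¹ * ((√2 : ℝ) : ℂ)⁻¹) * he

theorem vecMulVec_ghzProduct (d u : Fin 2 → ℂ) (φ : Finset (Fin N) → ℝ) (Λ : Partition N)
    {σ : ∀ A : Finset (Fin N), DensityMatrix (Config A)}
    (hσ : ∀ A : Finset (Fin N), A.Nonempty →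
      (σ A).matrix = vecMulVec (ghz d u (φ A) A) (star (ghz d u (φ A) A))) :
    vecMulVec (ghzProduct d u φ Λ) (star (ghzProduct d u φ Λ)) = productMatrix Λ σ := by
  ext x y
  rw [vecMulVec_apply, Pi.star_apply, ghzProduct, ghzProduct, star_prod, ← Finset.prod_mul_distrib,
    productMatrix]
  refine Finset.prod_congr rfl fun A hA => ?_
  rw [hσ A (Λ.nonempty_of_mem_parts hA), vecMulVec_apply, Pi.star_apply]

/-- `productMatrix` asks for a state on every finset, also on the empty one, where the GHZ vector
need not be normalised; the trivial state stands in there. -/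
theorem exists_ghzState {d u : Fin 2 → ℂ} (hd : star d ⬝ᵥ d = 1) (hu : star u ⬝ᵥ u = 1)
    (hdu : star d ⬝ᵥ u = 0) (φ : ℝ) (A : Finset (Fin N)) :
    ∃ σ : DensityMatrix (Config A), A.Nonempty →
      σ.matrix = vecMulVec (ghz d u φ A) (star (ghz d u φ A)) := by
  by_cases hA : A.Nonempty
  · refine ⟨⟨_, posSemidef_vecMulVec_self_star (ghz d u φ A), ?_⟩, fun _ => rfl⟩
    have h := ghz_dotProduct_tensorOp hd hu hdu φ hA (M := 1) (α := 1) (by simp) (by simp)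
    rw [map_one, Matrix.one_mulVec] at h
    rw [trace_vecMulVec, dotProduct_comm, h]
    simp
  · refine ⟨⟨1, PosSemidef.one, ?_⟩, fun h => (hA h).elim⟩
    rw [Finset.not_nonempty_iff_eq_empty] at hA
    subst hA
    simp [Matrix.trace_one]

theorem exists_isGHZProduct {n : EuclideanSpace ℝ (Fin 3)} (hn : ‖n‖ = 1) (Λ : Partition N) :
    ∃ ρ : DensityMatrix (Config (Fin N)), IsGHZProduct n Λ ρ := by
  obtain ⟨d, u, hd, hu, hMd, hMu⟩ := exists_eigenvectors_pauliDot hn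
  have hdu := star_dotProduct_eq_zero_of_eigen (pauliDot_isHermitian n) hMd hMu
  choose σ hσ using fun A : Finset (Fin N) => exists_ghzState hd hu hdu 0 A
  exact ⟨⟨productMatrix Λ σ, productMatrix_posSemidef Λ σ, trace_productMatrix Λ σ⟩, d, u,
    fun _ => 0, hd, hu, hMd, hMu, (vecMulVec_ghzProduct d u (fun _ => 0) Λ hσ).symm⟩

theorem IsGHZProduct.isSeparable {n : EuclideanSpace ℝ (Fin 3)} {Λ : Partition N}
    {ρ : DensityMatrix (Config (Fin N))} (hρ : IsGHZProduct n Λ ρ) : IsSeparable Λ ρ := by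
  obtain ⟨d, u, φ, hd, hu, hMd, hMu, hρ⟩ := hρ
  have hdu := star_dotProduct_eq_zero_of_eigen (pauliDot_isHermitian n) hMd hMu
  choose σ hσ using fun A : Finset (Fin N) => exists_ghzState hd hu hdu (φ A) A
  refine ⟨1, fun _ => 1, fun _ => σ, fun _ => zero_le_one, by simp, ?_⟩
  rw [hρ, vecMulVec_ghzProduct d u φ Λ hσ]
  simp

theorem IsGHZProduct.isWHSeparable {w h : ℕ} {n : EuclideanSpace ℝ (Fin 3)} (hn : ‖n‖ = 1)
    {Λ : Partition N} (hΛ : Λ ∈ classWH N w h) {ρ : DensityMatrix (Config (Fin N))}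
    (hρ : IsGHZProduct n Λ ρ) : IsWHSeparable w h ρ := by
  choose R hR using fun Λ' : Partition N => exists_isGHZProduct hn Λ'
  -- All weight sits on Λ, but partitions of weight 0 still need separable states; arbitrary GHZ
  -- products serve.
  refine ⟨Pi.single Λ 1, Function.update R Λ ρ, fun Λ' _ => ?_, ?_, fun Λ' _ => ?_, ?_⟩
  · rw [Pi.single_apply]
    split_ifs <;> norm_num
  · rw [Finset.sum_pi_single', if_pos hΛ]
  · rcases eq_or_ne Λ' Λ with rfl | hne
    · rw [Function.update_self]
      exact hρ.isSeparable
    · rw [Function.update_of_ne hne]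
      exact (hR Λ').isSeparable
  · rw [Finset.sum_eq_single_of_mem Λ hΛ fun Λ' _ hne => by simp [Pi.single_eq_of_ne hne]]
    simp

theorem mulSingle_mulVec_of_eigen {M : Matrix (Fin 2) (Fin 2) ℂ} {v : Fin 2 → ℂ} {a : ℂ}
    (h : M *ᵥ v = a • v) (i j : Fin N) :
    (Pi.mulSingle i M : Fin N → Matrix (Fin 2) (Fin 2) ℂ) j *ᵥ v =
      (Pi.mulSingle i a : Fin N → ℂ) j • v := by
  rcases eq_or_ne j i with rfl | hne
  · simpa using h
  · simp [Pi.mulSingle_eq_of_ne hne]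

theorem prod_coe_mulSingle (A : Finset (Fin N)) (i : Fin N) (a : ℂ) :
    ∏ j : A, (Pi.mulSingle i a : Fin N → ℂ) j = if i ∈ A then a else 1 := by
  rw [Finset.prod_coe_sort A (Pi.mulSingle i a : Fin N → ℂ), Finset.prod_pi_mulSingle']

/-- A product of GHZ states over `Λ` has quantum Fisher information equal to the sum of the
squared block sizes. -/
theorem IsGHZProduct.qfi_eq {n : EuclideanSpace ℝ (Fin 3)} {Λ : Partition N}
    {ρ : DensityMatrix (Config (Fin N))} (hρ : IsGHZProduct n Λ ρ) :
    qfi ρ (collectiveSpin N n) = sumSq Λ := by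
  obtain ⟨d, u, φ, hd, hu, hMd, hMu, hρ⟩ := hρ
  have hdu := star_dotProduct_eq_zero_of_eigen (pauliDot_isHermitian n) hMd hMu
  choose σ hσ using fun A : Finset (Fin N) => exists_ghzState hd hu hdu (φ A) A
  have hqfi := qfi_of_eq_vecMulVec hρ (collectiveSpin_isHermitian N n)
  rw [vecMulVec_ghzProduct d u φ Λ hσ] at hρ
  have hd' : pauliDot n *ᵥ d = (-1 : ℂ) • d := by rw [hMd, neg_one_smul]
  have hu' : pauliDot n *ᵥ u = (1 : ℂ) • u := by rw [hMu, one_smul]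
  have hexp : ∀ (M : Fin N → Matrix (Fin 2) (Fin 2) ℂ) (α : Fin N → ℂ),
      (∀ i, M i *ᵥ d = α i • d) → (∀ i, M i *ᵥ u = u) →
      (ρ.matrix * tensorOp M).trace = ∏ A ∈ Λ.parts, (∏ a : A, α a + 1) / 2 := by
    intro M α hα h1
    rw [hρ, trace_productMatrix_mul_tensorOp]
    refine Finset.prod_congr rfl fun A hA => ?_
    have hne := Λ.nonempty_of_mem_parts hA
    rw [hσ A hne, trace_vecMulVec_mul]
    exact ghz_dotProduct_tensorOp hd hu hdu (φ A) hne (fun a => hα a) fun a => h1 a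
  have hu1 : ∀ i j : Fin N, (Pi.mulSingle i (pauliDot n) :
      Fin N → Matrix (Fin 2) (Fin 2) ℂ) j *ᵥ u = u := fun i j => by
    rw [mulSingle_mulVec_of_eigen hu', Pi.mulSingle_one, Pi.one_apply, one_smul]
  have hone : ∀ i, (ρ.matrix * onSite i (pauliDot n)).trace = 0 := by
    intro i
    rw [onSite_eq_tensorOp, hexp _ _ (mulSingle_mulVec_of_eigen hd' i) (hu1 i)]
    obtain ⟨A, hA, hiA⟩ := Λ.exists_mem (Finset.mem_univ i)
    -- The block containing i contributes `(-1 + 1) / 2 = 0`.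
    refine Finset.prod_eq_zero hA ?_
    rw [prod_coe_mulSingle, if_pos hiA]
    norm_num
  have hsame : ∀ A ∈ Λ.parts, ∀ i ∈ A, ∀ j ∈ A,
      (ρ.matrix * (onSite i (pauliDot n) * onSite j (pauliDot n))).trace = 1 := by
    intro A hA i hi j hj
    rw [onSite_eq_tensorOp, onSite_eq_tensorOp, ← map_mul,
      hexp _ ((Pi.mulSingle i (-1) : Fin N → ℂ) * (Pi.mulSingle j (-1) : Fin N → ℂ))]
    · refine Finset.prod_eq_one fun B hB => ?_
      simp only [Pi.mul_apply, Finset.prod_mul_distrib, prod_coe_mulSingle]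
      -- A block contains both sites or neither, so the two signs cancel and each factor is `(1 + 1)
      -- / 2`.
      have hij : i ∈ B ↔ j ∈ B :=
        ⟨fun h => Λ.eq_of_mem_parts hA hB hi h ▸ hj, fun h => Λ.eq_of_mem_parts hA hB hj h ▸ hi⟩
      by_cases hjB : j ∈ B
      · rw [if_pos hjB, if_pos (hij.mpr hjB)]
        norm_num
      · rw [if_neg hjB, if_neg fun h => hjB (hij.mp h)]
        norm_num
    · intro k
      rw [Pi.mul_apply, ← Matrix.mulVec_mulVec, mulSingle_mulVec_of_eigen hd', Matrix.mulVec_smul,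
        mulSingle_mulVec_of_eigen hd', smul_smul, Pi.mul_apply, mul_comm]
    · intro k
      rw [Pi.mul_apply, ← Matrix.mulVec_mulVec, hu1, hu1]
  have hdiff : ∀ A ∈ Λ.parts, ∀ B ∈ Λ.parts, B ≠ A → ∀ i ∈ A, ∀ j ∈ B,
      (ρ.matrix * (onSite i (pauliDot n) * onSite j (pauliDot n))).trace = 0 := by
    intro A hA B hB hBA i hi j hj
    have h := trace_productMatrix_mul_mulSingle_mul Λ σ (pauliDot n) hA hB hBA.symm hi hj
    rw [← hρ, hone i, zero_mul] at h
    exact h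
  have hH : collectiveSpin N n = (1 / 2 : ℂ) • ∑ i : Fin N, onSite i (pauliDot n) := rfl
  have hmean : (ρ.matrix * collectiveSpin N n).trace = 0 := by
    rw [hH, Matrix.mul_smul, Matrix.mul_sum, trace_smul, trace_sum]
    simp [hone]
  have hsq : 4 * (ρ.matrix * (collectiveSpin N n * collectiveSpin N n)).trace = sumSq Λ := by
    have h4 : (4 : ℂ) * (1 / 2 * (1 / 2)) = 1 := by norm_num
    simp only [hH, Matrix.smul_mul, Matrix.mul_smul, smul_smul, trace_smul, smul_eq_mul]
    rw [← mul_assoc, h4, one_mul, Finset.sum_mul_sum, Matrix.mul_sum, trace_sum,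
      ← sum_parts_sum Λ, sumSq, Nat.cast_sum]
    refine Finset.sum_congr rfl fun A hA => ?_
    have hi : ∀ i ∈ A, (ρ.matrix * ∑ j, onSite i (pauliDot n) * onSite j (pauliDot n)).trace =
        (A.card : ℂ) := by
      intro i hi
      rw [Matrix.mul_sum, trace_sum, ← sum_parts_sum Λ,
        Finset.sum_eq_single_of_mem A hA fun B hB hBA =>
          Finset.sum_eq_zero fun j hj => hdiff A hA B hB hBA i hi j hj,
        Finset.sum_congr rfl fun j hj => hsame A hA i hi j hj]
      simp
    rw [Finset.sum_congr rfl hi, Finset.sum_const, nsmul_eq_mul, sq, Nat.cast_mul]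
  have hfin : (qfi ρ (collectiveSpin N n) : ℂ) = ((sumSq Λ : ℝ) : ℂ) := by
    rw [hqfi, hmean, mul_sub, hsq]
    simp
  exact_mod_cast hfin

end GHZ

end WHSep

theorem mainTheorem1 (N w h : ℕ) (hw : 1 ≤ w) (hh : h ≤ N)
    (n : EuclideanSpace ℝ (Fin 3)) (hn : ‖n‖ = 1) :
    (∀ ρ : WHSep.DensityMatrix (WHSep.Config (Fin N)), WHSep.IsWHSeparable w h ρ →
        WHSep.qfi ρ (WHSep.collectiveSpin N n) ≤ (WHSep.fMax N w h : ℝ) ∧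
        WHSep.qfi ρ (WHSep.collectiveSpin N n) ≤ (w : ℝ) * ((N : ℝ) - (h : ℝ)) + (N : ℝ)) ∧
    (WHSep.fMax N w h : ℝ) ≤ (w : ℝ) * ((N : ℝ) - (h : ℝ)) + (N : ℝ) ∧
    IsGreatest {F : ℝ | ∃ ρ : WHSep.DensityMatrix (WHSep.Config (Fin N)),
        WHSep.IsWHSeparable w h ρ ∧ WHSep.qfi ρ (WHSep.collectiveSpin N n) = F}
      (WHSep.fMax N w h : ℝ) ∧
    (∃ Λ ∈ WHSep.classWH N w h, WHSep.sumSq Λ = WHSep.fMax N w h) ∧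
    (∀ Λ ∈ WHSep.classWH N w h, WHSep.sumSq Λ = WHSep.fMax N w h →
        (∃ ρ : WHSep.DensityMatrix (WHSep.Config (Fin N)), WHSep.IsGHZProduct n Λ ρ) ∧
        ∀ ρ : WHSep.DensityMatrix (WHSep.Config (Fin N)), WHSep.IsGHZProduct n Λ ρ →
          WHSep.IsWHSeparable w h ρ ∧
          WHSep.qfi ρ (WHSep.collectiveSpin N n) = (WHSep.fMax N w h : ℝ)) := by
  obtain ⟨Λ, hΛ, hmax⟩ := WHSep.exists_sumSq_eq_fMax hw hh
  have hf : (WHSep.fMax N w h : ℝ) ≤ (w : ℝ) * ((N : ℝ) - (h : ℝ)) + (N : ℝ) :=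
    hmax ▸ WHSep.sumSq_le hΛ
  refine ⟨fun ρ hρ => ⟨WHSep.qfi_le_fMax hn hρ, (WHSep.qfi_le_fMax hn hρ).trans hf⟩, hf,
    ⟨?_, ?_⟩, ⟨Λ, hΛ, hmax⟩, fun Λ' hΛ' hmax' => ⟨WHSep.exists_isGHZProduct hn Λ', fun ρ hρ =>
      ⟨hρ.isWHSeparable hn hΛ', by rw [hρ.qfi_eq, hmax']⟩⟩⟩
  · obtain ⟨ρ, hρ⟩ := WHSep.exists_isGHZProduct hn Λ
    exact ⟨ρ, hρ.isWHSeparable hn hΛ, by rw [hρ.qfi_eq, hmax]⟩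
  · rintro F ⟨ρ, hρ, rfl⟩
    exact WHSep.qfi_le_fMax hn hρ
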